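/- Let $k$ be a field of characteristic $p>0$. A variety over $k$ is an integral scheme that is separated and of finite type over $k$. For an integral scheme $Z$, $K(Z)$ denotes its function field. Let $X$ be a variety over $k$ such that $k$ is algebraically closed in $K(X)$. A pair $(k\subset l\subset k',\ \varphi:X'\to X)$, consisting of field extensions $k\subset l\subset k'$ and a morphism $\varphi$ of schemes, is an elemental extension of $(k,X)$ if: $k\subset l$ is purely inseparable with $l^p\subset k$, and $X\times_k l$ is integral; $X'$ is the normalisation of $X\times_k l$; $\varphi$ is the induced morphism $X'\to X\times_k l\to X$; and $k'$ is the algebraic closure of $l$ in $K(X')$. Proposition. Let $f:X\to Y$ be a proper $k$-morphism of normal varieties over $k$ such that $f_*\mathcal O_X=\mathcal O_Y$ and $k$ is algebraically closed in $K(Y)$. Then $k$ is algebraically closed in $K(X)$. Let $(k\subset l\subset k_{X'},\ \varphi:X'\to X)$ be an elemental extension of $(k,X)$. Then: (1) $Y\times_k l$ is an integral scheme. Furthermore, let $Y'\to Y\times_k l$ be the normalisation of $Y\times_k l$, let $\psi:Y'\to Y$ be the induced morphism, and let $k_{Y'}$ be the algebraic closure of $l$ in $K(Y')$. Then: (2)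 $(k\subset l\subset k_{Y'},\ \psi:Y'\to Y)$ is an elemental extension of $(k,Y)$. (3) There is a dominant morphism $f':X'\to Y'$ compatible with $f\times_k l:X\times_k l\to Y\times_k l$, and under the induced inclusion $K(Y')\subset K(X')$ one has $l\subset k_{Y'}\subset k_{X'}$. (4) If $Y\times_k l$ is not normal, then $X\times_k l$ is not normal. -/

import Mathlib

open AlgebraicGeometry CategoryTheory CategoryTheory.Limits

universe u

namespace ElementalExt

noncomputable section

/-- A scheme is normal if all its local rings are integrally closed domains. -/
structure IsNormalScheme (X : Scheme.{u}) : Prop where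
  isDomain_stalk : ∀ x : X, IsDomain (X.presheaf.stalk x)
  isIntegrallyClosed_stalk : ∀ x : X, IsIntegrallyClosed (X.presheaf.stalk x)

/-- `f_* 𝒪_X = 𝒪_Y`: the canonical map `𝒪_Y → f_* 𝒪_X` is an isomorphism. -/
def PushforwardStructureSheafEq {X Y : Scheme.{u}} (f : X ⟶ Y) : Prop :=
  ∀ U : Y.Opens, Function.Bijective (f.app U).hom

/-- The ring homomorphism `k → K(X)` given by a `k`-scheme structure on an integral scheme. -/
def toFunctionField {k : Type u} [Field k] {X : Scheme.{u}} [IsIntegral X]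
    (s : X ⟶ Spec (.of k)) : k →+* X.functionField :=
  ((Scheme.ΓSpecIso (.of k)).inv ≫ s.appTop ≫
    X.presheaf.germ ⊤ (genericPoint X) trivial).hom

/-- A dominant morphism of integral schemes sends the generic point to the generic point. -/
theorem map_genericPoint {X Y : Scheme.{u}} [IsIntegral X] [IsIntegral Y] (f : X ⟶ Y)
    [IsDominant f] : f (genericPoint X) = genericPoint Y := by
  have h : IsGenericPoint (f (genericPoint X)) (closure (f '' Set.univ)) :=
    (genericPoint_spec X).image f.continuous
  rw [Set.image_univ, f.denseRange.closure_range] at h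
  exact h.eq (genericPoint_spec Y)

/-- The map `K(Y) → K(X)` induced by a dominant morphism `X ⟶ Y` of integral schemes. -/
def functionFieldMap {X Y : Scheme.{u}} [IsIntegral X] [IsIntegral Y] (f : X ⟶ Y)
    [IsDominant f] : Y.functionField →+* X.functionField :=
  (Y.presheaf.stalkSpecializes (specializes_of_eq (map_genericPoint f)) ≫
    f.stalkMap (genericPoint X)).hom

/-- `x` is algebraic over the field `F` with respect to `a : F → K`. -/
def AlgebraicElem {F K : Type*} [Field F] [Field K] (a : F →+* K) (x : K) : Prop :=
  ∃ q : Polynomial F, q ≠ 0 ∧ q.eval₂ a x = 0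

/-- `F` is algebraically closed in `K`. -/
def AlgebraicallyClosedIn {F K : Type*} [Field F] [Field K] (a : F →+* K) : Prop :=
  ∀ x : K, AlgebraicElem a x → x ∈ a.range

/-- The extension `E` of `F`, embedded in `K` by the `F`-homomorphism `ι`, is the algebraic
closure of `F` in `K`. -/
structure IsAlgebraicClosureIn {F E K : Type*} [Field F] [Field E] [Field K] [Algebra F E]
    (a : F →+* K) (ι : E →+* K) : Prop where
  comp_algebraMap : ι.comp (algebraMap F E) = a
  mem_range_iff : ∀ x : K, x ∈ ι.range ↔ AlgebraicElem a x

/-- `ν : Z' ⟶ Z` is the normalisation of the integral scheme `Z`: the scheme `Z'` is integral and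
normal, and `ν` is an integral, dominant morphism inducing an isomorphism of function fields
(by dominance, `ν` sends the generic point of `Z'` to that of `Z`). -/
structure IsNormalisation {Z' Z : Scheme.{u}} [IsIntegral Z'] (ν : Z' ⟶ Z) : Prop where
  isIntegral : IsIntegral Z
  isNormalScheme : IsNormalScheme Z'
  isIntegralHom : IsIntegralHom ν
  isDominant : IsDominant ν
  bijective_functionField : Function.Bijective (ν.stalkMap (genericPoint Z')).hom

section BaseChange

variable {k : Type u} [Field k] (l : Type u) [Field l] [Algebra k l]

/-- The scheme `X ×_k l`. -/
abbrev baseChange {X : Scheme.{u}} (s : X ⟶ Spec (.of k)) : Scheme.{u} :=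
  pullback s (Spec.map (CommRingCat.ofHom (algebraMap k l)))

/-- The projection `X ×_k l ⟶ X`. -/
abbrev baseChangeFst {X : Scheme.{u}} (s : X ⟶ Spec (.of k)) : baseChange l s ⟶ X :=
  pullback.fst _ _

/-- The structure morphism `X ×_k l ⟶ Spec l`. -/
abbrev baseChangeSnd {X : Scheme.{u}} (s : X ⟶ Spec (.of k)) :
    baseChange l s ⟶ Spec (.of l) :=
  pullback.snd _ _

/-- The morphism `f ×_k l : X ×_k l ⟶ Y ×_k l` induced by a `k`-morphism `f`. -/
def baseChangeMap {X Y : Scheme.{u}} {sX : X ⟶ Spec (.of k)} {sY : Y ⟶ Spec (.of k)}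
    (f : X ⟶ Y) (hf : f ≫ sY = sX) : baseChange l sX ⟶ baseChange l sY :=
  pullback.lift (baseChangeFst l sX ≫ f) (baseChangeSnd l sX)
    (by rw [Category.assoc, hf, pullback.condition])

end BaseChange

/-- `(k ⊂ l ⊂ k', φ : X' ⟶ X)` is an elemental extension of `(k, X)`, where `s` is the structure
morphism of the `k`-variety `X`, `ν : X' ⟶ X ×_k l` is the morphism through which `φ` factors,
and `ι : k' → K(X')` is the inclusion. The standing assumptions that `X` is a variety and that `k`
is algebraically closed in `K(X)` are not repeated here. -/
structure IsElementalExtension (p : ℕ) {k l k' : Type u} [Field k] [Field l] [Field k']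
    [Algebra k l] [Algebra l k'] {X X' : Scheme.{u}} [IsIntegral X'] (s : X ⟶ Spec (.of k))
    (φ : X' ⟶ X) (ν : X' ⟶ baseChange l s) (ι : k' →+* X'.functionField) : Prop where
  isPurelyInseparable : IsPurelyInseparable k l
  pow_mem : ∀ x : l, x ^ p ∈ (algebraMap k l).range
  isIntegral_baseChange : IsIntegral (baseChange l s)
  isNormalisation : IsNormalisation ν
  eq_induced : φ = ν ≫ baseChangeFst l s
  isAlgebraicClosureIn :
    IsAlgebraicClosureIn (toFunctionField (ν ≫ baseChangeSnd l s)) ι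

end

end ElementalExt

namespace ElementalExt

open TopologicalSpace Opposite

/-! Everything follows from `f_* 𝒪_X = 𝒪_Y` and normality. An element of `K(X)` algebraic over `k`
is integral over `Γ(X, ⊤)`, hence a global section of `X`, hence one of `Y`, where `k` is
algebraically closed. Flat base change along `k → l` identifies sections of `Y ×_k l` over preimages
of affine opens of `Y` with sections of `X ×_k l` (`bijective_app_baseChangeMap`). Reducedness and
normality thus pass from `X ×_k l` to `Y ×_k l`, and irreducibility passes because `f ×_k l` is
surjective. Finally `X'` is normal and dominates `Y ×_k l`, so it lifts to `Y'`
(`IsNormalisation.exists_lift`); the induced field map preserves algebraicity over `l`. -/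

/-! ### Sections of normal integral schemes inside the function field -/

/-- An element of the function field of an integral scheme that is regular at every point of a
nonempty open subset `U` is a section over `U`. -/
theorem mem_range_germToFunctionField {X : Scheme.{u}} [IsIntegral X] (U : X.Opens) [Nonempty U]
    (a : X.functionField)
    (ha : ∀ x ∈ U, a ∈ (algebraMap (X.presheaf.stalk x) X.functionField).range) :
    a ∈ (X.germToFunctionField U).hom.range := by
  have key : ∀ x : U, ∃ (V : X.Opens) (hV : V ≤ U) (_ : x.1 ∈ V) (s : Γ(X, V)),
      ∀ h : genericPoint X ∈ V, X.presheaf.germ V (genericPoint X) h s = a := by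
    intro x
    obtain ⟨t, ht⟩ := ha x.1 x.2
    obtain ⟨V, hxV, s, rfl⟩ := X.presheaf.exists_germ_eq t
    refine ⟨V ⊓ U, inf_le_right, ⟨hxV, x.2⟩, X.presheaf.map (homOfLE inf_le_left).op s, ?_⟩
    intro h
    have : Nonempty V := ⟨⟨x.1, hxV⟩⟩
    rw [← ht, Scheme.algebraMap_germ_eq_germToFunctionField]
    exact X.presheaf.germ_res_apply _ _ _ _
  choose V hVU hxV s hs using key
  have hgen : ∀ (W : X.Opens), (W : Set X).Nonempty → genericPoint X ∈ W := fun W hW ↦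
    ((genericPoint_spec X).mem_open_set_iff W.isOpen).mpr (by simpa using hW)
  -- On an integral scheme sections embed in the generic stalk, and all the local sections have germ
  -- `a` there.
  have hcompat : TopCat.Presheaf.IsCompatible X.presheaf V s := by
    intro i j
    have hmem : genericPoint X ∈ V i ⊓ V j :=
      ⟨hgen _ ⟨_, hxV i⟩, hgen _ ⟨_, hxV j⟩⟩
    apply germ_injective_of_isIntegral (X := X) (genericPoint X) hmem
    refine (X.presheaf.germ_res_apply _ _ _ _).trans
      (Eq.trans ?_ (X.presheaf.germ_res_apply _ _ _ _).symm)
    rw [hs, hs]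
  obtain ⟨t, ht, -⟩ := TopCat.Sheaf.existsUnique_gluing' X.sheaf V U (fun i ↦ homOfLE (hVU i))
    (fun x hx ↦ Opens.mem_iSup.mpr ⟨⟨x, hx⟩, hxV _⟩) s hcompat
  refine ⟨t, ?_⟩
  obtain ⟨x⟩ := ‹Nonempty U›
  rw [← hs x (hgen _ ⟨_, hxV x⟩), ← ht x]
  exact (X.presheaf.germ_res_apply _ _ _ _).symm

/-- Over a nonempty open subset, the sections of a normal integral scheme contain every element of
the function field integral over them. -/
theorem IsNormalScheme.mem_range_germToFunctionField {X : Scheme.{u}} [IsIntegral X]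
    (hX : IsNormalScheme X) (U : X.Opens) [Nonempty U] (a : X.functionField)
    (ha : (X.germToFunctionField U).hom.IsIntegralElem a) :
    a ∈ (X.germToFunctionField U).hom.range := by
  refine ElementalExt.mem_range_germToFunctionField U a fun x hx ↦ ?_
  have := hX.isIntegrallyClosed_stalk x
  have hint : IsIntegral (X.presheaf.stalk x) a := by
    obtain ⟨q, hq, hqa⟩ := ha
    refine ⟨q.map (X.presheaf.germ U x hx).hom, hq.map _, ?_⟩
    rw [Polynomial.eval₂_map, ← hqa]
    congr 1
    ext s
    exact Scheme.algebraMap_germ_eq_germToFunctionField X hx s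
  exact IsIntegrallyClosed.isIntegral_iff.mp hint

/-- The rings of sections of a normal integral scheme are integrally closed. -/
theorem IsNormalScheme.isIntegrallyClosed {X : Scheme.{u}} [IsIntegral X]
    (hX : IsNormalScheme X) (U : X.Opens) [Nonempty U] : IsIntegrallyClosed Γ(X, U) := by
  have hinj := X.germToFunctionField_injective U
  let g : FractionRing Γ(X, U) →+* X.functionField :=
    IsFractionRing.lift (g := (X.germToFunctionField U).hom) hinj
  have hg : ∀ s, g (algebraMap _ _ s) = X.germToFunctionField U s :=
    fun s ↦ IsFractionRing.lift_algebraMap hinj s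
  refine (isIntegrallyClosed_iff (FractionRing Γ(X, U))).mpr fun {x} hx ↦ ?_
  obtain ⟨q, hq, hqx⟩ := hx
  obtain ⟨s, hs⟩ := hX.mem_range_germToFunctionField U (g x) ⟨q, hq, by
    have := congr(g $hqx)
    rw [Polynomial.hom_eval₂, map_zero] at this
    rw [← this]
    congr 1
    ext s
    exact (hg s).symm⟩
  exact ⟨s, g.injective ((hg s).trans hs)⟩

/-- If `f : X ⟶ Y` is bijective on global sections, `X` is normal and `k` is algebraically closed in
`K(Y)`, then `k` is algebraically closed in `K(X)`. -/
theorem algebraicallyClosedIn_of_pushforward {k : Type u} [Field k] {X Y : Scheme.{u}}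
    [IsIntegral X] [IsIntegral Y] {sX : X ⟶ Spec (.of k)} {sY : Y ⟶ Spec (.of k)}
    (hX : IsNormalScheme X) (f : X ⟶ Y) (hf : f ≫ sY = sX)
    (hfO : Function.Bijective f.appTop.hom)
    (hkY : AlgebraicallyClosedIn (toFunctionField sY)) :
    AlgebraicallyClosedIn (toFunctionField sX) := by
  intro x ⟨q, hq0, hq⟩
  have : Nonempty (⊤ : X.Opens) := ⟨⟨genericPoint X, trivial⟩⟩
  have : Nonempty (⊤ : Y.Opens) := ⟨⟨genericPoint Y, trivial⟩⟩
  let c : k →+* Γ(Y, ⊤) := ((Scheme.ΓSpecIso (.of k)).inv ≫ sY.appTop).hom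
  have hcY : toFunctionField sY = (Y.germToFunctionField ⊤).hom.comp c := rfl
  have hcX : toFunctionField sX = (X.germToFunctionField ⊤).hom.comp (f.appTop.hom.comp c) := by
    subst hf
    rw [toFunctionField, Scheme.Hom.comp_appTop]
    rfl
  obtain ⟨s, rfl⟩ := hX.mem_range_germToFunctionField ⊤ x (by
    have h1 : (toFunctionField sX).IsIntegralElem x := by
      refine ⟨q * Polynomial.C q.leadingCoeff⁻¹, Polynomial.monic_mul_leadingCoeff_inv hq0, ?_⟩
      rw [Polynomial.eval₂_mul, hq, zero_mul]
    rw [hcX] at h1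
    exact RingHom.IsIntegralElem.of_comp h1)
  obtain ⟨t, rfl⟩ := hfO.2 s
  have ht : q.eval₂ c t = 0 := by
    rw [hcX, ← Polynomial.hom_eval₂, ← Polynomial.hom_eval₂] at hq
    exact (map_eq_zero_iff _ hfO.1).mp
      ((map_eq_zero_iff _ (X.germToFunctionField_injective ⊤)).mp hq)
  obtain ⟨b, hb⟩ := hkY (Y.germToFunctionField ⊤ t) ⟨q, hq0, by
    rw [hcY]
    exact (Polynomial.hom_eval₂ q c (Y.germToFunctionField ⊤).hom t).symm.trans
      (by rw [ht, map_zero])⟩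
  have hbt : c b = t := Y.germToFunctionField_injective ⊤ hb
  exact ⟨b, by rw [hcX, ← hbt]; rfl⟩

/-! ### Lifting along integral morphisms and normalisations -/

/-- A normal integral scheme is its own relative normalisation in its function field. -/
theorem IsNormalScheme.isIso_fromNormalization {X : Scheme.{u}} [IsIntegral X]
    (hX : IsNormalScheme X) :
    IsIso (X.fromSpecStalk (genericPoint X)).fromNormalization := by
  set g := X.fromSpecStalk (genericPoint X)
  have hcov : ⨆ U : {U : X.affineOpens // Nonempty U.1}, U.1.1 = ⊤ := by
    rw [eq_top_iff]
    intro x _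
    obtain ⟨_, ⟨A, hA, rfl⟩, hxA, -⟩ :=
      X.isBasis_affineOpens.exists_subset_of_mem_open (Set.mem_univ x) isOpen_univ
    exact Opens.mem_iSup.mpr ⟨⟨⟨A, hA⟩, ⟨⟨x, hxA⟩⟩⟩, hxA⟩
  refine (IsZariskiLocalAtTarget.iff_of_iSup_eq_top (P := .isomorphisms Scheme) _ hcov).mpr ?_
  rintro ⟨⟨U, hU⟩, hne⟩
  refine (isIso_morphismRestrict_iff_isIso_app _ hU).mpr ?_
  have hηU : genericPoint X ∈ U :=
    ((genericPoint_spec X).mem_open_set_iff U.isOpen).mpr (by simpa using hne)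
  have htop : g ⁻¹ᵁ U = ⊤ := by
    refine Scheme.preimage_eq_top_of_closedPoint_mem g ?_
    rwa [Scheme.fromSpecStalk_closedPoint]
  let e : X.functionField ≅ Γ(Spec X.functionField, g ⁻¹ᵁ U) :=
    (Scheme.ΓSpecIso X.functionField).symm ≪≫
      (Spec X.functionField).presheaf.mapIso (eqToIso htop).op
  have happ : g.app U = X.germToFunctionField U ≫ e.hom := by
    exact Scheme.fromSpecStalk_app hηU
  let := (g.app U).hom.toAlgebra
  -- Over `U` the relative normalisation is the integral closure of `Γ(X, U)` in `K(X)`, which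
  -- normality makes equal to `Γ(X, U)`.
  have hbij : Function.Bijective
      (algebraMap Γ(X, U) (integralClosure Γ(X, U) Γ(Spec X.functionField, g ⁻¹ᵁ U))) := by
    constructor
    · intro a b hab
      have h1 : g.app U a = g.app U b := congrArg Subtype.val hab
      rw [happ] at h1
      exact X.germToFunctionField_injective U (e.commRingCatIsoToRingEquiv.injective h1)
    · rintro ⟨y, hy⟩
      obtain ⟨z, rfl⟩ := e.commRingCatIsoToRingEquiv.surjective y
      obtain ⟨q, hq, hqz⟩ := hy
      obtain ⟨s, rfl⟩ := hX.mem_range_germToFunctionField U z ⟨q, hq, by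
        have h2 : q.eval₂ (e.hom.hom.comp (X.germToFunctionField U).hom) (e.hom z) = 0 := by
          rw [← hqz]
          congr 1
          exact congr(($happ).hom).symm
        rw [← Polynomial.hom_eval₂] at h2
        exact (map_eq_zero_iff _ e.commRingCatIsoToRingEquiv.injective).mp h2⟩
      exact ⟨s, Subtype.ext (congr(($happ).hom s))⟩
  rw [Scheme.Hom.fromNormalization_app _ hU]
  have : IsIso (CommRingCat.ofHom (algebraMap Γ(X, U)
      (integralClosure Γ(X, U) Γ(Spec X.functionField, g ⁻¹ᵁ U)))) :=
    (ConcreteCategory.isIso_iff_bijective _).mpr hbij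
  infer_instance

/-- A lift at the generic point of a normal integral scheme along an integral morphism extends to a
lift on the whole scheme. -/
theorem IsNormalScheme.exists_lift {X T S : Scheme.{u}} [IsIntegral X] (hX : IsNormalScheme X)
    (h : X ⟶ S) (ν : T ⟶ S) [IsIntegralHom ν] (g : Spec X.functionField ⟶ T)
    (hg : g ≫ ν = X.fromSpecStalk (genericPoint X) ≫ h) :
    ∃ h' : X ⟶ T, h' ≫ ν = h ∧ X.fromSpecStalk (genericPoint X) ≫ h' = g := by
  have := hX.isIso_fromNormalization
  set i := X.fromSpecStalk (genericPoint X)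
  -- The pullback is integral over `X`, so the universal property of the relative normalisation,
  -- here `X` itself, extends `f₁` to a section over `X`.
  let f₁ : Spec X.functionField ⟶ pullback h ν := pullback.lift i g hg.symm
  have H : i = f₁ ≫ pullback.fst h ν := (pullback.lift_fst _ _ _).symm
  have hi : i ≫ inv i.fromNormalization = i.toNormalization := by
    rw [IsIso.comp_inv_eq, i.toNormalization_fromNormalization]
  refine ⟨inv i.fromNormalization ≫ i.normalizationDesc f₁ (pullback.fst h ν) H ≫
    pullback.snd h ν, ?_, ?_⟩
  · rw [Category.assoc, Category.assoc, ← pullback.condition,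
      Scheme.Hom.normalizationDesc_comp_assoc, IsIso.inv_hom_id_assoc]
  · rw [reassoc_of% hi, Scheme.Hom.toNormalization_normalizationDesc_assoc]
    exact pullback.lift_snd _ _ _

/-- A dominant morphism from a normal integral scheme lifts to the normalisation of its target. -/
theorem IsNormalisation.exists_lift {X Z' Z : Scheme.{u}} [IsIntegral X] [IsIntegral Z']
    (hX : IsNormalScheme X) {ν : Z' ⟶ Z} (hν : IsNormalisation ν) (h : X ⟶ Z) [IsDominant h] :
    ∃ (h' : X ⟶ Z') (_ : IsDominant h'), h' ≫ ν = h := by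
  have := hν.isIntegral
  have := hν.isIntegralHom
  have := hν.isDominant
  have hiso : IsIso (ν.stalkMap (genericPoint Z')) :=
    (ConcreteCategory.isIso_iff_bijective _).mpr hν.bijective_functionField
  have heq : ν (genericPoint Z') = h (genericPoint X) := by
    rw [map_genericPoint, map_genericPoint]
  have hsp' : h (genericPoint X) ⤳ ν (genericPoint Z') := specializes_of_eq heq.symm
  -- The lift at the generic point is `K(Z') ≅ K(Z) → K(X)`.
  let φ : Z'.functionField ⟶ X.functionField :=
    inv (ν.stalkMap (genericPoint Z')) ≫ Z.presheaf.stalkSpecializes hsp' ≫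
      h.stalkMap (genericPoint X)
  obtain ⟨h', h1, h2⟩ := hX.exists_lift h ν
    (Spec.map φ ≫ Z'.fromSpecStalk (genericPoint Z')) (by
      rw [Category.assoc, ← Scheme.SpecMap_stalkMap_fromSpecStalk, ← Spec.map_comp_assoc,
        IsIso.hom_inv_id_assoc, Spec.map_comp_assoc,
        Scheme.SpecMap_stalkSpecializes_fromSpecStalk, Scheme.SpecMap_stalkMap_fromSpecStalk])
  refine ⟨h', ⟨?_⟩, h1⟩
  have hgen : h' (genericPoint X) = genericPoint Z' := by
    let y : Spec X.functionField := IsLocalRing.closedPoint X.functionField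
    have hy : X.fromSpecStalk (genericPoint X) y = genericPoint X :=
      Scheme.fromSpecStalk_closedPoint
    have hφ : Spec.map φ y = IsLocalRing.closedPoint Z'.functionField :=
      Subsingleton.elim (α := PrimeSpectrum _) _ _
    have h3 : (X.fromSpecStalk (genericPoint X) ≫ h') y =
        (Spec.map φ ≫ Z'.fromSpecStalk (genericPoint Z')) y := by rw [h2]
    rw [Scheme.Hom.comp_apply, Scheme.Hom.comp_apply, hy, hφ] at h3
    exact h3.trans Scheme.fromSpecStalk_closedPoint
  rw [DenseRange, dense_iff_closure_eq, ← Set.univ_subset_iff, ← (genericPoint_spec Z').def]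
  exact closure_mono (Set.singleton_subset_iff.mpr ⟨_, hgen⟩)

/-! ### Base change along a field extension -/

section BaseChange

variable {k : Type u} [Field k] (l : Type u) [Field l] [Algebra k l]
  {X Y : Scheme.{u}} {sX : X ⟶ Spec (.of k)} {sY : Y ⟶ Spec (.of k)} (f : X ⟶ Y)

instance flat_baseChangeFst : Flat (baseChangeFst l sX) := by
  have : Flat (Spec.map (CommRingCat.ofHom (algebraMap k l))) :=
    (HasRingHomProperty.Spec_iff (P := @Flat)).mpr (RingHom.flat_algebraMap_iff.mpr inferInstance)
  infer_instance

instance isAffineHom_baseChangeFst : IsAffineHom (baseChangeFst l sX) :=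
  MorphismProperty.of_isPullback (P := @IsAffineHom) (IsPullback.of_hasPullback _ _).flip
    (isAffineHom_of_isAffine (Spec.map (CommRingCat.ofHom (algebraMap k l))))

theorem isPullback_baseChangeMap (hf : f ≫ sY = sX) :
    IsPullback (baseChangeFst l sX) (baseChangeMap l f hf) f (baseChangeFst l sY) := by
  have h := IsPullback.of_hasPullback sX (Spec.map (CommRingCat.ofHom (algebraMap k l)))
  refine IsPullback.of_bot (v₂₁ := baseChangeSnd l sY) (v₂₂ := sY)
    (h₃₁ := Spec.map (CommRingCat.ofHom (algebraMap k l))) ?_ ?_ (IsPullback.of_hasPullback _ _)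
  · rw [hf, baseChangeMap, pullback.lift_snd]
    exact h
  · rw [baseChangeMap, pullback.lift_fst]

/-- The image is closed, so density suffices. Over a nonempty open set missing the image, a nonzero
ring would inject into the zero ring. -/
theorem surjective_of_injective_app [IsIntegral X] [IsIntegral Y] [IsProper f]
    (hfO : ∀ U : Y.Opens, Function.Injective (f.app U).hom) : Surjective f := by
  have hd : DenseRange f := by
    rw [DenseRange, dense_iff_inter_open]
    intro U hU hne
    by_contra hemp
    let V : Y.Opens := ⟨U, hU⟩
    have : Nonempty V := hne.to_subtype
    have hV : f ⁻¹ᵁ V = ⊥ := by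
      ext x
      refine ⟨fun hx ↦ hemp ⟨f x, hx, Set.mem_range_self x⟩, fun h ↦ h.elim⟩
    have hs : Subsingleton Γ(X, f ⁻¹ᵁ V) := by
      rw [hV]; infer_instance
    exact zero_ne_one (hfO V (Subsingleton.elim _ _) : (0 : Γ(Y, V)) = 1)
  refine ⟨Set.range_eq_univ.mp ?_⟩
  rw [← f.isClosedMap.isClosed_range.closure_eq]
  exact hd.closure_range

/-- Flat base change for `f_* 𝒪_X = 𝒪_Y` along a field extension, over affine open sets. -/
theorem bijective_app_baseChangeMap [QuasiCompact f] [QuasiSeparated f] (hf : f ≫ sY = sX)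
    (hfO : PushforwardStructureSheafEq f) {U : Y.Opens} (hU : IsAffineOpen U) :
    Function.Bijective ((baseChangeMap l f hf).app (baseChangeFst l sY ⁻¹ᵁ U)).hom := by
  have H := isPullback_baseChangeMap l f hf
  have hW := hU.preimage (baseChangeFst l sY)
  have hUY : baseChangeMap l f hf ⁻¹ᵁ (baseChangeFst l sY ⁻¹ᵁ U) =
    baseChangeFst l sX ⁻¹ᵁ (f ⁻¹ᵁ U) ⊓ baseChangeMap l f hf ⁻¹ᵁ (baseChangeFst l sY ⁻¹ᵁ U) := by
    rw [← Scheme.Hom.comp_preimage, ← Scheme.Hom.comp_preimage, H.w, inf_idem]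
  have h1 := isIso_pushoutSection_of_isQuasiSeparated_of_flat_right H le_rfl le_rfl hUY
    hU hW (f.isCompact_preimage hU.isCompact) (f.isQuasiSeparated_preimage hU.isQuasiSeparated)
  rw [isIso_pushoutSection_iff] at h1
  have : IsIso (f.appLE U (f ⁻¹ᵁ U) le_rfl) := by
    rw [← Scheme.Hom.app_eq_appLE]
    exact (ConcreteCategory.isIso_iff_bijective _).mpr (hfO U)
  -- In the pushout square of section rings, the map opposite the isomorphism `f.app U` is an
  -- isomorphism.
  have h2 := h1.isIso_inr_of_isIso
  rw [← Scheme.Hom.app_eq_appLE] at h2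
  exact (ConcreteCategory.isIso_iff_bijective _).mp h2

theorem exists_isAffineOpen_mem_preimage_baseChangeFst (y : baseChange l sY) :
    ∃ U : Y.Opens, IsAffineOpen U ∧ y ∈ baseChangeFst l sY ⁻¹ᵁ U := by
  obtain ⟨_, ⟨A, hA, rfl⟩, hxA, -⟩ :=
    Y.isBasis_affineOpens.exists_subset_of_mem_open
      (Set.mem_univ (baseChangeFst l sY y)) isOpen_univ
  exact ⟨A, hA, hxA⟩

variable [IsIntegral X] [IsIntegral Y]

theorem isIntegral_baseChange_of_pushforward [IsProper f] (hf : f ≫ sY = sX)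
    (hfO : PushforwardStructureSheafEq f) [IsIntegral (baseChange l sX)] :
    IsIntegral (baseChange l sY) := by
  have := surjective_of_injective_app f fun U ↦ (hfO U).1
  have hs : Surjective (baseChangeMap l f hf) :=
    MorphismProperty.of_isPullback (isPullback_baseChangeMap l f hf) this
  have : IrreducibleSpace (baseChange l sY) :=
    hs.1.irreducibleSpace (baseChangeMap l f hf).continuous
  have (y : baseChange l sY) : _root_.IsReduced ((baseChange l sY).presheaf.stalk y) := by
    obtain ⟨U, hU, hy⟩ := exists_isAffineOpen_mem_preimage_baseChangeFst l y
    have hW := hU.preimage (baseChangeFst l sY)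
    have hr : _root_.IsReduced Γ(baseChange l sY, baseChangeFst l sY ⁻¹ᵁ U) :=
      isReduced_of_injective _ (bijective_app_baseChangeMap l f hf hfO hU).1
    let := TopCat.Presheaf.algebra_section_stalk (baseChange l sY).presheaf ⟨y, hy⟩
    have := hW.isLocalization_stalk ⟨y, hy⟩
    exact isReduced_localizationPreserves (hW.primeIdealOf ⟨y, hy⟩).asIdeal.primeCompl _ hr
  have : IsReduced (baseChange l sY) := isReduced_of_isReduced_stalk _
  exact isIntegral_of_irreducibleSpace_of_isReduced _

/-- Section rings of a normal integral scheme are integrally closed even over non-affine opens, such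
as the preimage of an affine open of `Y`; stalks of `Y ×_k l` are localisations of such rings. -/
theorem isNormalScheme_baseChange_of_pushforward [IsProper f] (hf : f ≫ sY = sX)
    (hfO : PushforwardStructureSheafEq f) [IsIntegral (baseChange l sX)]
    (h : IsNormalScheme (baseChange l sX)) : IsNormalScheme (baseChange l sY) := by
  have := isIntegral_baseChange_of_pushforward l f hf hfO
  refine ⟨fun y ↦ inferInstance, fun y ↦ ?_⟩
  have := surjective_of_injective_app f fun U ↦ (hfO U).1
  have hs : Surjective (baseChangeMap l f hf) :=
    MorphismProperty.of_isPullback (isPullback_baseChangeMap l f hf) this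
  obtain ⟨U, hU, hy⟩ := exists_isAffineOpen_mem_preimage_baseChangeFst l y
  have hW := hU.preimage (baseChangeFst l sY)
  obtain ⟨x, hx⟩ := hs.1 y
  have : Nonempty (baseChangeMap l f hf ⁻¹ᵁ (baseChangeFst l sY ⁻¹ᵁ U)) :=
    ⟨⟨x, by rwa [← hx] at hy⟩⟩
  have hc := h.isIntegrallyClosed (baseChangeMap l f hf ⁻¹ᵁ (baseChangeFst l sY ⁻¹ᵁ U))
  have := IsIntegrallyClosed.of_equiv
    (RingEquiv.ofBijective _ (bijective_app_baseChangeMap l f hf hfO hU)).symm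
  have : Nonempty (baseChangeFst l sY ⁻¹ᵁ U) := ⟨⟨_, hy⟩⟩
  let := TopCat.Presheaf.algebra_section_stalk (baseChange l sY).presheaf ⟨y, hy⟩
  have := hW.isLocalization_stalk ⟨y, hy⟩
  exact isIntegrallyClosed_of_isLocalization _
    (hW.primeIdealOf ⟨y, hy⟩).asIdeal.primeCompl (Ideal.primeCompl_le_nonZeroDivisors _)

end BaseChange

/-! ### Function field maps and relative algebraic closures -/

theorem functionFieldMap_comp_toFunctionField {k : Type u} [Field k] {X Y : Scheme.{u}}
    [IsIntegral X] [IsIntegral Y] (f : X ⟶ Y) [IsDominant f] (sY : Y ⟶ Spec (.of k)) :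
    (functionFieldMap f).comp (toFunctionField sY) = toFunctionField (f ≫ sY) := by
  have h1 (hY : genericPoint Y ∈ (⊤ : Y.Opens)) (hX : genericPoint X ∈ (⊤ : X.Opens)) :
      Y.presheaf.germ ⊤ (genericPoint Y) hY ≫
        Y.presheaf.stalkSpecializes (specializes_of_eq (map_genericPoint f)) ≫
          f.stalkMap (genericPoint X) = f.appTop ≫ X.presheaf.germ ⊤ (genericPoint X) hX := by
    rw [TopCat.Presheaf.germ_stalkSpecializes_assoc, Scheme.Hom.germ_stalkMap]
    rfl
  rw [functionFieldMap, toFunctionField, toFunctionField, ← CommRingCat.hom_comp,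
    Scheme.Hom.comp_appTop, Category.assoc, Category.assoc, Category.assoc]
  exact congrArg (fun φ ↦ ((Scheme.ΓSpecIso (.of k)).inv ≫ sY.appTop ≫ φ).hom)
    (h1 trivial trivial)

theorem AlgebraicElem.map {F K L : Type*} [Field F] [Field K] [Field L] {a : F →+* K}
    {x : K} (h : AlgebraicElem a x) (m : K →+* L) : AlgebraicElem (m.comp a) (m x) := by
  obtain ⟨q, hq, hqx⟩ := h
  exact ⟨q, hq, by rw [← Polynomial.hom_eval₂, hqx, map_zero]⟩

/-- A homomorphism of field extensions of `F` restricts to the algebraic closures of `F`. -/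
theorem IsAlgebraicClosureIn.exists_algHom {F E E' K K' : Type*} [Field F] [Field E] [Field E']
    [Field K] [Field K'] [Algebra F E] [Algebra F E'] {a : F →+* K} {a' : F →+* K'}
    {ι : E →+* K} {ι' : E' →+* K'} (h : IsAlgebraicClosureIn a ι)
    (h' : IsAlgebraicClosureIn a' ι') (m : K →+* K') (hm : m.comp a = a') :
    ∃ j : E →ₐ[F] E', ∀ x, ι' (j x) = m (ι x) := by
  have hx : ∀ x, ∃ y, ι' y = m (ι x) := fun x ↦
    (h'.mem_range_iff _).mpr (hm ▸ ((h.mem_range_iff _).mp ⟨x, rfl⟩).map m)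
  choose j hj using hx
  refine ⟨{ toFun := j, map_one' := ?_, map_mul' := ?_, map_zero' := ?_, map_add' := ?_,
            commutes' := ?_ }, hj⟩
  · exact ι'.injective (by simp [hj])
  · exact fun x y ↦ ι'.injective (by simp [hj])
  · exact ι'.injective (by simp [hj])
  · exact fun x y ↦ ι'.injective (by simp [hj])
  · intro c
    apply ι'.injective
    rw [hj]
    have h1 := RingHom.congr_fun h.comp_algebraMap c
    have h2 := RingHom.congr_fun h'.comp_algebraMap c
    rw [RingHom.comp_apply] at h1 h2
    rw [h1, h2, ← hm, RingHom.comp_apply]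

end ElementalExt

theorem mainTheorem9 (p : ℕ) (hp : p.Prime) {k : Type u} [Field k] [CharP k p]
    {X Y : Scheme.{u}} [IsIntegral X] [IsIntegral Y]
    (sX : X ⟶ Spec (.of k)) (sY : Y ⟶ Spec (.of k))
    [IsSeparated sX] [LocallyOfFiniteType sX] [QuasiCompact sX]
    [IsSeparated sY] [LocallyOfFiniteType sY] [QuasiCompact sY]
    (hX : ElementalExt.IsNormalScheme X) (hY : ElementalExt.IsNormalScheme Y)
    (f : X ⟶ Y) (hf : f ≫ sY = sX) [IsProper f]
    (hfO : ElementalExt.PushforwardStructureSheafEq f)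
    (hkY : ElementalExt.AlgebraicallyClosedIn (ElementalExt.toFunctionField sY)) :
    ElementalExt.AlgebraicallyClosedIn (ElementalExt.toFunctionField sX) ∧
    ∀ {l kX' : Type u} [Field l] [Field kX'] [Algebra k l] [Algebra l kX']
      {X' : Scheme.{u}} [IsIntegral X'] (φ : X' ⟶ X)
      (νX : X' ⟶ ElementalExt.baseChange l sX) (ιX : kX' →+* X'.functionField),
      ElementalExt.IsElementalExtension p sX φ νX ιX →
      IsIntegral (ElementalExt.baseChange l sY) ∧
      (∀ {kY' : Type u} [Field kY'] [Algebra l kY'] {Y' : Scheme.{u}} [IsIntegral Y']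
        (νY : Y' ⟶ ElementalExt.baseChange l sY) (ιY : kY' →+* Y'.functionField),
        ElementalExt.IsNormalisation νY →
        ElementalExt.IsAlgebraicClosureIn
          (ElementalExt.toFunctionField (νY ≫ ElementalExt.baseChangeSnd l sY)) ιY →
        ElementalExt.IsElementalExtension p sY
          (νY ≫ ElementalExt.baseChangeFst l sY) νY ιY ∧
        -- the inclusion `k_{Y'} ⊂ k_{X'}` over `l`, inside `K(Y') ⊂ K(X')`
        ∃ (f' : X' ⟶ Y') (_ : IsDominant f'),
          f' ≫ νY = νX ≫ ElementalExt.baseChangeMap l f hf ∧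
          ∃ j : kY' →ₐ[l] kX', ∀ a : kY',
            ιX (j a) = ElementalExt.functionFieldMap f' (ιY a)) ∧
      (¬ ElementalExt.IsNormalScheme (ElementalExt.baseChange l sY) →
        ¬ ElementalExt.IsNormalScheme (ElementalExt.baseChange l sX)) := by
  open ElementalExt in
  refine ⟨algebraicallyClosedIn_of_pushforward hX f hf (hfO ⊤) hkY, ?_⟩
  intro l kX' _ _ _ _ X' _ φ νX ιX hE
  have := hE.isIntegral_baseChange
  have hYl := isIntegral_baseChange_of_pushforward l f hf hfO
  refine ⟨hYl, ?_, mt (isNormalScheme_baseChange_of_pushforward l f hf hfO)⟩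
  intro kY' _ _ Y' _ νY ιY hνY hιY
  refine ⟨⟨hE.isPurelyInseparable, hE.pow_mem, hYl, hνY, rfl, hιY⟩, ?_⟩
  have := surjective_of_injective_app f fun U ↦ (hfO U).1
  have : Surjective (baseChangeMap l f hf) :=
    MorphismProperty.of_isPullback (isPullback_baseChangeMap l f hf) this
  have := hE.isNormalisation.isDominant
  obtain ⟨f', hf', h⟩ := hνY.exists_lift hE.isNormalisation.isNormalScheme
    (νX ≫ baseChangeMap l f hf)
  refine ⟨f', hf', h, hιY.exists_algHom hE.isAlgebraicClosureIn (functionFieldMap f') ?_⟩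
  -- The field map is `l`-linear because `f ×_k l` commutes with the projections to `Spec l`.
  rw [functionFieldMap_comp_toFunctionField, ← Category.assoc, h, Category.assoc,
    baseChangeMap, pullback.lift_snd]
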